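/- Notation: $[n]=\{1,\dots,n\}$; $\preceq$ is the coordinatewise order on $\mathbb{Z}^m$. For integers $n\ge 1$ and $k\ge 0$, $\textsc{Tarski}^*(n,k)$ is the following problem. Given oracle access to a function $g:[n]^k\to\{-1,0,1\}^{k+1}$ such that - $x_i+g(x)_i\in[n]$ for all $x\in[n]^k$ and $i\in[k]$, and - $(x,0)+g(x)\preceq (y,0)+g(y)$ for all $x,y\in[n]^k$ with $x\preceq y$, find a point $x\in[n]^k$ such that either $g(x)_i\le 0$ for all $i\in[k+1]$, or $g(x)_i\ge 0$ for all $i\in[k+1]$. A (deterministic, adaptive) query algorithm is given $n$ and $k$. In each round it either stops and returns a point of $[n]^k$, or sends a query $x\in[n]^k$ and learns $g(x)$; each round's choice may depend on the previous answers. Its cost on $g$ is the number of queries it makes. **Lemma.** There is a query algorithm that solves $\textsc{Tarski}^*(n,k)$, for all $n\ge 1$ and $k\ge 0$, and that for every fixed $k$ makes $O(\log^{\lceil k/2\rceil} n)$ queries: for every $k$ there is a constant $C_k$ such that for every $n\ge 1$ and every admissible $g:[n]^k\to\{-1,0,1\}^{k+1}$ it makes at most $C_k\,(\log n)^{\lceil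 k/2\rceil}$ queries on $g$ (where $(\log n)^0=1$). -/

import Mathlib

/-- The set `[n] = {1, …, n}`, as a set of integers. -/
abbrev Side (n : ℕ) : Type := Set.Icc (1 : ℤ) (n : ℤ)

/-- The grid `[n]^k`. Its order is the coordinatewise one: `x ≤ y ↔ ∀ i, x i ≤ y i`. -/
abbrev Grid (n k : ℕ) : Type := Fin k → Side n

/-- Sign vectors `{-1, 0, 1}^m`. -/
abbrev SignVec (m : ℕ) : Type := Fin m → SignType

/-- The vector `(x, 0) + s` of `ℤ^(k+1)`, for `x` in `[n]^k` and `s` in `{-1, 0, 1}^(k+1)`. -/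
def shift {n k : ℕ} (x : Grid n k) (s : SignVec (k + 1)) : Fin (k + 1) → ℤ :=
  Fin.snoc (α := fun _ => ℤ) (fun i => (x i : ℤ)) 0 + fun j => (s j : ℤ)

/-- The admissible inputs `g : [n]^k → {-1, 0, 1}^(k+1)` of Tarski*(n, k). The first `k` coordinates
are those of the form `i.castSucc`, and the last one is `Fin.last k`. -/
structure IsTarskiStarInput {n k : ℕ} (g : Grid n k → SignVec (k + 1)) : Prop where
  /-- `x_i + g(x)_i` lies in `[n]` for every `i` in `[k]`. -/
  mem : ∀ (x : Grid n k) (i : Fin k),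
    (x i : ℤ) + (g x i.castSucc : ℤ) ∈ Set.Icc (1 : ℤ) (n : ℤ)
  /-- `(x, 0) + g(x) ≼ (y, 0) + g(y)` whenever `x ≼ y`. -/
  mono : ∀ x y : Grid n k, x ≤ y → shift x (g x) ≤ shift y (g y)

/-- The solutions of Tarski*(n, k) on the input `g`. -/
def IsTarskiStarSolution {n k : ℕ} (g : Grid n k → SignVec (k + 1)) (x : Grid n k) : Prop :=
  (∀ i, g x i ≤ 0) ∨ (∀ i, 0 ≤ g x i)

/-- Deterministic adaptive query algorithms with queries in `Q`, oracle answers in `A` and outputs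
in `R`: an algorithm either stops with an output, or asks a query and continues in a way that
depends on the answer. -/
inductive QueryAlgorithm (Q A R : Type) : Type where
  | output (r : R) : QueryAlgorithm Q A R
  | query (q : Q) (next : A → QueryAlgorithm Q A R) : QueryAlgorithm Q A R

/-- The output of an algorithm when its queries are answered by the oracle `g`. -/
def QueryAlgorithm.run {Q A R : Type} (g : Q → A) : QueryAlgorithm Q A R → R
  | .output r => r
  | .query q next => (next (g q)).run g

/-- The number of queries that an algorithm makes when they are answered by the oracle `g`. -/
def QueryAlgorithm.numQueries {Q A R : Type} (g : Q → A) : QueryAlgorithm Q A R → ℕ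
  | .output _ => 0
  | .query q next => (next (g q)).numQueries g + 1

/-- Query algorithms for Tarski*(n, k): they query points of `[n]^k`, are answered by sign vectors
in `{-1, 0, 1}^(k+1)`, and return a point of `[n]^k`. -/
abbrev TarskiStarAlgorithm (n k : ℕ) : Type :=
  QueryAlgorithm (Grid n k) (SignVec (k + 1)) (Grid n k)

/-- The algorithm `T` solves Tarski*(n, k). -/
def SolvesTarskiStar {n k : ℕ} (T : TarskiStarAlgorithm n k) : Prop :=
  ∀ g : Grid n k → SignVec (k + 1), IsTarskiStarInput g → IsTarskiStarSolution g (T.run g)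

/-! The plane costs O(log n) queries (`solvable_two`), and when the coordinates are split into two
groups the costs multiply up to a constant factor (`Solvable.sum`). Splitting off two coordinates at
a time gives one factor log n per pair.

In the plane, a box is kept that satisfies one-sided conditions on its sides. The four corners of
its central cell either contain a solution or allow one side to be halved.

For the product, the outer algorithm runs on x ↦ g(x, y(x)) for a monotone section y that is never
fixed. Only monotone bounds L ≤ y ≤ R are kept. An outer query at x is answered by shrinking [L(x),
R(x)], with calls to the inner algorithm, until every outer sign is constant there; the answer then
holds for all remaining sections. In the output slice, one end of the shrunken interval has inner
signs that agree with the outer ones. -/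

/-! ### Calculus of query algorithms -/

section QueryAlgorithms

variable {Q A R S : Type}

/-- Sequential composition of query algorithms. -/
def QueryAlgorithm.bind : QueryAlgorithm Q A R → (R → QueryAlgorithm Q A S) → QueryAlgorithm Q A S
  | .output r, f => f r
  | .query q next, f => .query q fun a => (next a).bind f

theorem QueryAlgorithm.run_bind (g : Q → A) (T : QueryAlgorithm Q A R)
    (f : R → QueryAlgorithm Q A S) : (T.bind f).run g = (f (T.run g)).run g := by
  induction T with
  | output r => rfl
  | query q next ih => exact ih (g q)

theorem QueryAlgorithm.numQueries_bind (g : Q → A) (T : QueryAlgorithm Q A R)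
    (f : R → QueryAlgorithm Q A S) :
    (T.bind f).numQueries g = T.numQueries g + (f (T.run g)).numQueries g := by
  induction T with
  | output r => simp [QueryAlgorithm.bind, numQueries, run]
  | query q next ih => simp [QueryAlgorithm.bind, numQueries, run, ih]; ring

/-- Replace each query `q` by the query `φ q`, and translate the answer `a` to `ψ q a`. -/
def QueryAlgorithm.simulate {Q' A' : Type} (φ : Q' → Q) (ψ : Q' → A → A') :
    QueryAlgorithm Q' A' R → QueryAlgorithm Q A R
  | .output r => .output r
  | .query q next => .query (φ q) fun a => (next (ψ q a)).simulate φ ψ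

theorem QueryAlgorithm.run_simulate {Q' A' : Type} (φ : Q' → Q) (ψ : Q' → A → A') (g : Q → A)
    (T : QueryAlgorithm Q' A' R) :
    (T.simulate φ ψ).run g = T.run fun q => ψ q (g (φ q)) := by
  induction T with
  | output r => rfl
  | query q next ih => exact ih _

theorem QueryAlgorithm.numQueries_simulate {Q' A' : Type} (φ : Q' → Q) (ψ : Q' → A → A')
    (g : Q → A) (T : QueryAlgorithm Q' A' R) :
    (T.simulate φ ψ).numQueries g = T.numQueries fun q => ψ q (g (φ q)) := by
  induction T with
  | output r => rfl
  | query q next ih => exact congrArg (· + 1) (ih _)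

/-- Some algorithm has, on each oracle in `𝒢`, an output related to the oracle by `P`, and makes at
most `d` queries on it. -/
def Achieves (𝒢 : (Q → A) → Prop) (d : ℕ) (P : (Q → A) → R → Prop) : Prop :=
  ∃ T : QueryAlgorithm Q A R, ∀ g, 𝒢 g → P g (T.run g) ∧ T.numQueries g ≤ d

theorem Achieves.pure {𝒢 : (Q → A) → Prop} {P : (Q → A) → R → Prop} (d : ℕ) (r : R)
    (h : ∀ g, 𝒢 g → P g r) : Achieves 𝒢 d P :=
  ⟨.output r, fun g hg => ⟨h g hg, Nat.zero_le _⟩⟩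

theorem Achieves.query (𝒢 : (Q → A) → Prop) (q : Q) : Achieves 𝒢 1 fun g a => g q = a :=
  ⟨.query q .output, fun _ _ => ⟨rfl, le_rfl⟩⟩

/-- What the first algorithm has learned becomes a promise on the oracle for the second. All later
arguments pass on information in this way. -/
theorem Achieves.bind {𝒢 : (Q → A) → Prop} {d e : ℕ} {P : (Q → A) → R → Prop}
    {P' : (Q → A) → S → Prop} (h : Achieves 𝒢 d P)
    (h' : ∀ r, Achieves (fun g => 𝒢 g ∧ P g r) e P') : Achieves 𝒢 (d + e) P' := by
  obtain ⟨T, hT⟩ := h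
  choose U hU using h'
  refine ⟨T.bind U, fun g hg => ?_⟩
  have h1 := hT g hg
  have h2 := hU (T.run g) g ⟨hg, h1.1⟩
  rw [QueryAlgorithm.run_bind, QueryAlgorithm.numQueries_bind]
  exact ⟨h2.1, add_le_add h1.2 h2.2⟩

theorem Achieves.mono {𝒢 𝒢' : (Q → A) → Prop} {d d' : ℕ} {P P' : (Q → A) → R → Prop}
    (h : Achieves 𝒢 d P) (h𝒢 : ∀ g, 𝒢' g → 𝒢 g) (hd : d ≤ d')
    (hP : ∀ g r, 𝒢' g → P g r → P' g r) : Achieves 𝒢' d' P' := by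
  obtain ⟨T, hT⟩ := h
  exact ⟨T, fun g hg => ⟨hP _ _ hg (hT g (h𝒢 g hg)).1, (hT g (h𝒢 g hg)).2.trans hd⟩⟩

theorem Achieves.simulate {Q' A' : Type} {𝒢 : (Q' → A') → Prop} {d : ℕ}
    {P : (Q' → A') → R → Prop} (h : Achieves 𝒢 d P) (φ : Q' → Q) (ψ : Q' → A → A') :
    Achieves (fun g : Q → A => 𝒢 fun q => ψ q (g (φ q))) d
      fun g r => P (fun q => ψ q (g (φ q))) r := by
  obtain ⟨T, hT⟩ := h
  refine ⟨T.simulate φ ψ, fun g hg => ?_⟩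
  rw [QueryAlgorithm.run_simulate, QueryAlgorithm.numQueries_simulate]
  exact hT _ hg

theorem Achieves.queryList [Inhabited A] (𝒢 : (Q → A) → Prop) (l : List Q) :
    Achieves 𝒢 l.length fun g (F : Q → A) => ∀ q ∈ l, F q = g q := by
  classical
  induction l with
  | nil => exact .pure _ default (by simp)
  | cons q l ih =>
    rw [List.length_cons]
    refine ih.bind fun F => ?_
    refine (Achieves.query _ q).bind (e := 0) fun a => .pure _ (Function.update F q a) ?_
    rintro g ⟨⟨-, hF⟩, ha⟩ p hp
    by_cases h : p = q
    · subst h; simp [ha]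
    · rw [Function.update_of_ne h]
      exact hF p ((List.mem_cons.1 hp).resolve_left h)

end QueryAlgorithms

/-! ### Comparison of signs as integers -/

section Signs

theorem SignType.intCast_le {s t : SignType} : (s : ℤ) ≤ (t : ℤ) ↔ s ≤ t := by
  revert s t; decide

theorem SignType.intCast_nonneg {s : SignType} : (0 : ℤ) ≤ s ↔ 0 ≤ s := by
  revert s; decide

theorem SignType.intCast_nonpos {s : SignType} : (s : ℤ) ≤ 0 ↔ s ≤ 0 := by
  revert s; decide

end Signs

/-! ### Tarski* over arbitrary index types -/

/-- The admissible inputs of Tarski*, for coordinates in `ι` and with the last sign at `none`. -/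
structure Admissible {ι : Type} {n : ℕ} (g : (ι → Side n) → Option ι → SignType) : Prop where
  mem : ∀ x i, (x i : ℤ) + (g x (some i) : ℤ) ∈ Set.Icc (1 : ℤ) (n : ℤ)
  mono : ∀ x y, x ≤ y → ∀ i,
    (x i : ℤ) + (g x (some i) : ℤ) ≤ (y i : ℤ) + (g y (some i) : ℤ)
  mono_none : ∀ x y, x ≤ y → g x none ≤ g y none

/-- The solutions of Tarski*, for coordinates in `ι`. -/
def Solution {ι : Type} {n : ℕ} (g : (ι → Side n) → Option ι → SignType) (x : ι → Side n) : Prop :=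
  (∀ j, g x j ≤ 0) ∨ (∀ j, 0 ≤ g x j)

/-- Tarski* with coordinates in `ι` can be solved with `d` queries. -/
def Solvable (n : ℕ) (ι : Type) (d : ℕ) : Prop :=
  Achieves (Q := ι → Side n) (A := Option ι → SignType) Admissible d Solution

theorem Solvable.mono {n : ℕ} {ι : Type} {d e : ℕ} (h : Solvable n ι d) (hde : d ≤ e) :
    Solvable n ι e :=
  Achieves.mono h (fun _ h => h) hde fun _ _ _ h => h

/-- Points with the same `i`-th coordinate have monotone `i`-th signs. -/
theorem Admissible.sign_le {ι : Type} {n : ℕ} {g : (ι → Side n) → Option ι → SignType}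
    (hg : Admissible g) {x y : ι → Side n} (hxy : x ≤ y) {i : ι} (hi : x i = y i) :
    g x (some i) ≤ g y (some i) := by
  have := hg.mono x y hxy i
  rw [hi] at this
  exact SignType.intCast_le.1 (by linarith)

theorem Solvable.reindex {n : ℕ} {ι κ : Type} {d : ℕ} (h : Solvable n ι d) (e : ι ≃ κ) :
    Solvable n κ d := by
  have h1 := Achieves.simulate h (fun x k => x (e.symm k))
    (fun _ (a : Option κ → SignType) (j : Option ι) => a (j.map e))
  refine Achieves.mono (h1.bind (P' := Solution) (e := 0)
    fun r => .pure _ (fun k => r (e.symm k)) ?_) ?_ le_rfl fun _ _ _ h => h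
  · rintro g ⟨hg, hs⟩
    rcases hs with hs | hs
    · exact .inl fun j => by simpa using hs (j.map e.symm)
    · exact .inr fun j => by simpa using hs (j.map e.symm)
  · intro g hg
    refine ⟨fun x i => ?_, fun x y hxy i => ?_, fun x y hxy => ?_⟩
    · simpa using hg.mem (fun k => x (e.symm k)) (e i)
    · simpa using hg.mono (fun k => x (e.symm k)) (fun k => y (e.symm k)) (fun k => hxy _) (e i)
    · exact hg.mono_none _ _ fun k => hxy _

/-- The coordinates in `β` are dummies: they are ignored by the oracle and always get the sign 0. -/
theorem Solvable.of_sum {n : ℕ} {α β : Type} {d : ℕ} (h : Solvable n (α ⊕ β) d) :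
    Solvable n α d := by
  have h1 := Achieves.simulate h (fun x k => x (Sum.inl k))
    (fun _ (a : Option α → SignType) (j : Option (α ⊕ β)) =>
      j.elim (a none) (Sum.elim (fun i => a (some i)) fun _ => 0))
  refine Achieves.mono (h1.bind (P' := Solution) (e := 0)
    fun r => .pure _ (fun k => r (Sum.inl k)) ?_) ?_ le_rfl fun _ _ _ h => h
  · rintro g ⟨hg, hs⟩
    rcases hs with hs | hs
    · exact .inl fun j => by cases j <;> [exact hs none; exact hs (some (Sum.inl _))]
    · exact .inr fun j => by cases j <;> [exact hs none; exact hs (some (Sum.inl _))]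
  · intro g hg
    refine ⟨?_, ?_, fun x y hxy => ?_⟩
    · rintro x (i | i)
      · simpa using hg.mem (fun k => x (Sum.inl k)) i
      · simp
    · rintro x y hxy (i | i)
      · simpa using hg.mono (fun k => x (Sum.inl k)) (fun k => y (Sum.inl k)) (fun k => hxy _) i
      · simpa using hxy (Sum.inr i)
    · exact hg.mono_none _ _ fun k => hxy _

theorem solvable_of_isEmpty (n : ℕ) (ι : Type) [IsEmpty ι] : Solvable n ι 0 := by
  refine Achieves.pure 0 (fun i => isEmptyElim i) fun g _ => ?_
  rcases le_total (g (fun i => isEmptyElim i) none) 0 with h | h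
  · exact .inl fun j => by cases j with
      | none => exact h
      | some i => exact isEmptyElim i
  · exact .inr fun j => by cases j with
      | none => exact h
      | some i => exact isEmptyElim i

/-! ### The plane: halving a box -/

section Planar

variable {n : ℕ}

/-- On the sides of the box `[lo, hi]`, points with nonnegative last sign do not leave it through a
lower side, and points with negative last sign do not leave it through an upper side. -/
structure BoxInvariant (g : (Fin 2 → Side n) → Option (Fin 2) → SignType)
    (lo hi : Fin 2 → Side n) : Prop where
  le : lo ≤ hi
  lower : ∀ x, lo ≤ x → x ≤ hi → ∀ i, x i = lo i → 0 ≤ g x none → 0 ≤ g x (some i)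
  upper : ∀ x, lo ≤ x → x ≤ hi → ∀ i, x i = hi i → g x none < 0 → g x (some i) ≤ 0

/-- This is where dimension two matters: an axis-parallel line is totally ordered, so one query on
it gives information about all its points. -/
theorem fin_two_le_of_eq {i : Fin 2} {x y : Fin 2 → Side n} (hi : x i = y i)
    (h : x (1 - i) ≤ y (1 - i)) : x ≤ y := by
  intro j
  fin_cases i <;> fin_cases j <;> first | exact hi.le | exact h

/-- On the new side, points below `m` inherit the nonpositive sign `i` of `m`, and points above `m`
inherit its nonnegative last sign, which makes the condition vacuous. -/
theorem BoxInvariant.cut_upper {g : (Fin 2 → Side n) → Option (Fin 2) → SignType}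
    {lo hi m : Fin 2 → Side n} (hg : Admissible g) (h : BoxInvariant g lo hi) (hlo : lo ≤ m)
    (hhi : m ≤ hi) {i : Fin 2} (hm : 0 ≤ g m none) (hs : g m (some i) ≤ 0) :
    BoxInvariant g lo (Function.update hi i (m i)) := by
  have hle : Function.update hi i (m i) ≤ hi := by
    rw [update_le_self_iff]; exact hhi i
  refine ⟨?_, fun x h1 h2 => h.lower x h1 (h2.trans hle), fun x h1 h2 j hj hx => ?_⟩
  · rw [le_update_iff]; exact ⟨hlo i, fun j _ => h.le j⟩
  · by_cases hji : j = i
    · subst hji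
      rw [Function.update_self] at hj
      rcases le_total (x (1 - j)) (m (1 - j)) with hc | hc
      · exact (hg.sign_le (fin_two_le_of_eq hj hc) hj).trans hs
      · exact absurd (hm.trans (hg.mono_none _ _ (fin_two_le_of_eq hj.symm hc))) (not_le.2 hx)
    · rw [Function.update_of_ne hji] at hj
      exact h.upper x h1 (h2.trans hle) j hj hx

theorem BoxInvariant.cut_lower {g : (Fin 2 → Side n) → Option (Fin 2) → SignType}
    {lo hi m : Fin 2 → Side n} (hg : Admissible g) (h : BoxInvariant g lo hi) (hlo : lo ≤ m)
    (hhi : m ≤ hi) {i : Fin 2} (hm : g m none < 0) (hs : 0 ≤ g m (some i)) :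
    BoxInvariant g (Function.update lo i (m i)) hi := by
  have hle : lo ≤ Function.update lo i (m i) := by
    rw [le_update_self_iff]; exact hlo i
  refine ⟨?_, fun x h1 h2 j hj hx => ?_, fun x h1 h2 => h.upper x (hle.trans h1) h2⟩
  · rw [update_le_iff]; exact ⟨hhi i, fun j _ => h.le j⟩
  · by_cases hji : j = i
    · subst hji
      rw [Function.update_self] at hj
      rcases le_total (x (1 - j)) (m (1 - j)) with hc | hc
      · exact absurd ((hg.mono_none _ _ (fin_two_le_of_eq hj hc)).trans_lt hm) (not_lt.2 hx)
      · exact hs.trans (hg.sign_le (fin_two_le_of_eq hj.symm hc) hj.symm)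
    · rw [Function.update_of_ne hji] at hj
      exact h.lower x (hle.trans h1) h2 j hj hx

/-- The corner of the box `[c, c']` that is selected by `e`. -/
def corner (c c' : Fin 2 → Side n) (e : Fin 2 → Bool) : Fin 2 → Side n :=
  fun i => if e i then c' i else c i

theorem corner_mono {c c' : Fin 2 → Side n} (h : c ≤ c') {e e' : Fin 2 → Bool} (he : e ≤ e') :
    corner c c' e ≤ corner c c' e' := by
  intro i
  have h1 := he i
  have h2 := h i
  unfold corner
  cases h3 : e i <;> cases h4 : e' i <;>
    simp_all only [Bool.false_eq_true, if_true, if_false, le_refl]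
  exact absurd (h1 rfl) Bool.false_ne_true

/-- A cell of side length at most one has a solution among its corners if its sides satisfy the
conditions of `BoxInvariant`. -/
theorem exists_corner_solution {g : (Fin 2 → Side n) → Option (Fin 2) → SignType}
    (hg : Admissible g) {c c' : Fin 2 → Side n} (hc : c ≤ c')
    (hc' : ∀ i, (c' i : ℤ) ≤ (c i : ℤ) + 1)
    (hlow : ∀ e i, e i = false → 0 ≤ g (corner c c' e) none → 0 ≤ g (corner c c' e) (some i))
    (hup : ∀ e i, e i = true → g (corner c c' e) none < 0 → g (corner c c' e) (some i) ≤ 0) :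
    ∃ e, Solution g (corner c c' e) := by
  by_contra! hno
  have sol_up : ∀ e, 0 ≤ g (corner c c' e) none → 0 ≤ g (corner c c' e) (some 0) →
      0 ≤ g (corner c c' e) (some 1) → False := fun e h h0 h1 => hno e <| .inr fun j => by
    rcases j with _ | j
    · exact h
    · fin_cases j <;> assumption
  have sol_down : ∀ e, g (corner c c' e) none < 0 → g (corner c c' e) (some 0) ≤ 0 →
      g (corner c c' e) (some 1) ≤ 0 → False := fun e h h0 h1 => hno e <| .inl fun j => by
    rcases j with _ | j
    · exact h.le
    · fin_cases j <;> assumption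
  -- Without a solution, the last sign must change between the lowest and the highest corner.
  have hA : g (corner c c' fun _ => false) none < 0 := not_le.1 fun h =>
    sol_up _ h (hlow _ 0 rfl h) (hlow _ 1 rfl h)
  have hB : 0 ≤ g (corner c c' fun _ => true) none := not_lt.1 fun h =>
    sol_down _ h (hup _ 0 rfl h) (hup _ 1 rfl h)
  -- Corners differ by at most 1 in each coordinate, so a sign 1 can drop at most to 0 on the way
  -- up.
  have step : ∀ (i : Fin 2) (e e' : Fin 2 → Bool), e ≤ e' → 0 < g (corner c c' e) (some i) →
      0 ≤ g (corner c c' e') (some i) := by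
    intro i e e' he h
    have h1 := hg.mono _ _ (corner_mono hc he) i
    have h2 : ((corner c c' e' i : Side n) : ℤ) ≤ (corner c c' e i : Side n) + 1 := by
      have := hc' i
      have : (c i : ℤ) ≤ c' i := hc i
      unfold corner
      split <;> split <;> linarith
    have h3 : (1 : ℤ) ≤ (g (corner c c' e) (some i) : ℤ) := by
      revert h; generalize g (corner c c' e) (some i) = s; revert s; decide
    exact SignType.intCast_nonneg.1 (by linarith)
  -- In the direction `i`, the lower left corner points inwards.
  have main : ∀ i j : Fin 2, i ≠ j → 0 < g (corner c c' fun _ => false) (some i) →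
      False := by
    intro i j hij hi
    have sol_up' : ∀ e, 0 ≤ g (corner c c' e) none → 0 ≤ g (corner c c' e) (some i) →
        0 ≤ g (corner c c' e) (some j) → False := by
      intro e h h1 h2
      fin_cases i <;> fin_cases j <;>
        first | exact hij rfl | exact sol_up e h h1 h2 | exact sol_up e h h2 h1
    have sol_down' : ∀ e, g (corner c c' e) none < 0 → g (corner c c' e) (some i) ≤ 0 →
        g (corner c c' e) (some j) ≤ 0 → False := by
      intro e h h1 h2
      fin_cases i <;> fin_cases j <;>
        first | exact hij rfl | exact sol_down e h h1 h2 | exact sol_down e h h2 h1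
    have hBj : g (corner c c' fun _ => true) (some j) < 0 := not_le.1 fun h =>
      sol_up' _ hB (step i _ _ (fun _ => Bool.false_le _) hi) h
    set P : Fin 2 → Bool := Function.update (fun _ => false) i true with hP
    have hPi : P i = true := by simp [hP]
    have hPj : P j = false := by simp [hP, hij.symm]
    -- The mixed corner `P` is a solution for either value of its last sign.
    by_cases hb : g (corner c c' P) none < 0
    · refine sol_down' P hb (hup P i hPi hb) (not_lt.1 fun h => ?_)
      exact absurd (step j P _ (fun _ => Bool.le_true _) h) (not_le.2 hBj)
    · rw [not_lt] at hb
      exact sol_up' P hb (step i _ P (fun _ => Bool.false_le _) hi) (hlow P j hPj hb)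
  by_cases h0 : 0 < g (corner c c' fun _ => false) (some 0)
  · exact main 0 1 (by decide) h0
  by_cases h1 : 0 < g (corner c c' fun _ => false) (some 1)
  · exact main 1 0 (by decide) h1
  exact sol_down _ hA (not_lt.1 h0) (not_lt.1 h1)

/-- The lower of the two middle points of `[lo, hi]`. -/
def lowerMid (lo hi : Fin 2 → Side n) : Fin 2 → Side n := fun i =>
  ⟨((lo i : ℤ) + hi i) / 2, by
    have h1 := (lo i).2
    have h2 := (hi i).2
    simp only [Set.mem_Icc] at h1 h2 ⊢
    omega⟩

/-- The upper of the two middle points of `[lo, hi]`. -/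
def upperMid (lo hi : Fin 2 → Side n) : Fin 2 → Side n := fun i =>
  ⟨min (((lo i : ℤ) + hi i) / 2 + 1) (hi i), by
    have h1 := (lo i).2
    have h2 := (hi i).2
    simp only [Set.mem_Icc] at h1 h2 ⊢
    omega⟩

/-- Here `t i` bounds the halvings left for side `i`, and `m` their total. A round costs four
queries and either stops or lowers `m` by one; the extra four queries pay for the last round. -/
theorem achieves_box (m : ℕ) : ∀ (t : Fin 2 → ℕ) (lo hi : Fin 2 → Side n), lo ≤ hi →
    t 0 + t 1 = m → (∀ i, (hi i : ℤ) - lo i < 2 ^ t i) →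
    Achieves (fun g => Admissible g ∧ BoxInvariant g lo hi) (4 * (m + 1)) Solution := by
  classical
  induction m using Nat.strong_induction_on with
  | _ m ih =>
  intro t lo hi hle hm ht
  set c := lowerMid lo hi with hcdef
  set c' := upperMid lo hi with hcdef'
  have hle' : ∀ i, (lo i : ℤ) ≤ hi i := fun i => hle i
  have hcv : ∀ i, (c i : ℤ) = ((lo i : ℤ) + hi i) / 2 := fun i => rfl
  have hcv' : ∀ i, (c' i : ℤ) = min (((lo i : ℤ) + hi i) / 2 + 1) (hi i) := fun i => rfl
  have hloc : lo ≤ c := fun i => Subtype.coe_le_coe.1 (by have := hle' i; rw [hcv]; omega)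
  have hcc' : c ≤ c' := fun i => Subtype.coe_le_coe.1 (by have := hle' i; rw [hcv, hcv']; omega)
  have hchi : c' ≤ hi := fun i => Subtype.coe_le_coe.1 (by rw [hcv']; omega)
  have hloe : ∀ e, lo ≤ corner c c' e := fun e =>
    hloc.trans fun i => by unfold corner; split; exacts [hcc' i, le_rfl]
  have hehi : ∀ e, corner c c' e ≤ hi := fun e =>
    le_trans (fun i => by unfold corner; split; exacts [le_rfl, hcc' i]) hchi
  have hquery := Achieves.queryList
    (fun g : (Fin 2 → Side n) → Option (Fin 2) → SignType => Admissible g ∧ BoxInvariant g lo hi)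
    ((Finset.univ : Finset (Fin 2 → Bool)).toList.map (corner c c'))
  have hlen : ((Finset.univ : Finset (Fin 2 → Bool)).toList.map (corner c c')).length = 4 := by
    simp
  rw [hlen] at hquery
  have hquery' : Achieves _ 4 fun g (F : _ → Option (Fin 2) → SignType) =>
      ∀ e, F (corner c c' e) = g (corner c c' e) :=
    hquery.mono (fun _ h => h) le_rfl fun g F _ h e =>
      h _ (List.mem_map_of_mem (Finset.mem_toList.2 (Finset.mem_univ e)))
  refine (hquery'.bind (P' := Solution) (e := 4 * m) fun F => ?_).mono (fun _ h => h) (by omega)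
    fun _ _ _ h => h
  have hpos : ∀ i, lo i ≠ hi i → 1 ≤ t i := fun i hne => by
    by_contra h0
    have h1 := ht i
    rw [show t i = 0 by omega] at h1
    exact hne (Subtype.ext (by have := hle' i; omega))
  have hsum : ∀ i, 1 ≤ t i →
      (Function.update t i (t i - 1)) 0 + (Function.update t i (t i - 1)) 1 = m - 1 := by
    intro i hi
    fin_cases i <;> simp at hi ⊢ <;> omega
  by_cases hsol : ∃ e, Solution F (corner c c' e)
  · obtain ⟨e, he⟩ := hsol
    refine .pure _ (corner c c' e) ?_
    rintro g ⟨-, hF⟩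
    rwa [Solution, hF] at he
  by_cases hhigh : ∃ e i, e i = false ∧ 0 ≤ F (corner c c' e) none ∧
      F (corner c c' e) (some i) < 0
  · obtain ⟨e, i, hei, hb, hs⟩ := hhigh
    have hci : corner c c' e i = c i := by simp [corner, hei]
    -- On a side of length 0 the corner contradicts the promise, so any output will do.
    by_cases hne : lo i = hi i
    · refine .pure _ lo ?_
      rintro g ⟨⟨hg, hI⟩, hF⟩
      rw [hF] at hb hs
      refine absurd (hI.lower _ (hloe e) (hehi e) i ?_ hb) (not_le.2 hs)
      exact le_antisymm ((hehi e i).trans hne.ge) (hloe e i)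
    have hti := hpos i hne
    refine (ih (m - 1) (by have := hsum i hti; fin_cases i <;> simp at hti <;> omega)
      (Function.update t i (t i - 1)) lo (Function.update hi i (corner c c' e i)) ?_
      (hsum i hti) ?_).mono ?_ (by have := hsum i hti; fin_cases i <;> simp at hti <;> omega)
      fun _ _ _ h => h
    · rw [le_update_iff]; exact ⟨hloe e i, fun j _ => hle j⟩
    · intro j
      by_cases hji : j = i
      · subst hji
        have h1 := ht j
        obtain ⟨s, hs⟩ := Nat.exists_eq_add_of_le' hti
        rw [hs, pow_succ] at h1
        simp only [Function.update_self, hci, hcv, hs, Nat.add_sub_cancel]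
        omega
      · simpa [hji] using ht j
    · rintro g ⟨⟨hg, hI⟩, hF⟩
      rw [hF] at hb hs
      exact ⟨hg, hI.cut_upper hg (hloe e) (hehi e) hb hs.le⟩
  by_cases hlow : ∃ e i, e i = true ∧ F (corner c c' e) none < 0 ∧
      0 < F (corner c c' e) (some i)
  · obtain ⟨e, i, hei, hb, hs⟩ := hlow
    have hci : corner c c' e i = c' i := by simp [corner, hei]
    by_cases hne : lo i = hi i
    · refine .pure _ lo ?_
      rintro g ⟨⟨hg, hI⟩, hF⟩
      rw [hF] at hb hs
      refine absurd (hI.upper _ (hloe e) (hehi e) i ?_ hb) (not_le.2 hs)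
      exact le_antisymm (hehi e i) (hne.ge.trans (hloe e i))
    have hti := hpos i hne
    have hlt : (lo i : ℤ) < hi i := lt_of_le_of_ne (hle' i) fun h => hne (Subtype.ext h)
    refine (ih (m - 1) (by have := hsum i hti; fin_cases i <;> simp at hti <;> omega)
      (Function.update t i (t i - 1)) (Function.update lo i (corner c c' e i)) hi ?_
      (hsum i hti) ?_).mono ?_ (by have := hsum i hti; fin_cases i <;> simp at hti <;> omega)
      fun _ _ _ h => h
    · rw [update_le_iff]; exact ⟨hehi e i, fun j _ => hle j⟩
    · intro j
      by_cases hji : j = i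
      · subst hji
        have h1 := ht j
        obtain ⟨s, hs⟩ := Nat.exists_eq_add_of_le' hti
        rw [hs, pow_succ] at h1
        simp only [Function.update_self, hci, hcv', hs, Nat.add_sub_cancel]
        omega
      · simpa [hji] using ht j
    · rintro g ⟨⟨hg, hI⟩, hF⟩
      rw [hF] at hb hs
      exact ⟨hg, hI.cut_lower hg (hloe e) (hehi e) hb hs.le⟩
  -- This case is impossible by `exists_corner_solution`, so the output is arbitrary.
  refine .pure _ lo ?_
  rintro g ⟨⟨hg, hI⟩, hF⟩
  push Not at hsol hhigh hlow
  obtain ⟨e, he⟩ := exists_corner_solution hg hcc' (fun i => by rw [hcv, hcv']; omega)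
    (fun e i hei hb => by rw [← hF] at hb ⊢; exact hhigh e i hei hb)
    (fun e i hei hb => by rw [← hF] at hb ⊢; exact hlow e i hei hb)
  refine (hsol e ?_).elim
  rwa [Solution, hF]

theorem solvable_two (hn : 1 ≤ n) {t : ℕ} (ht : n ≤ 2 ^ t) :
    Solvable n (Fin 2) (4 * (2 * t + 1)) := by
  have h1 : (1 : ℤ) ≤ n := by exact_mod_cast hn
  have ht' : (n : ℤ) ≤ 2 ^ t := by exact_mod_cast ht
  refine (achieves_box (2 * t) (fun _ => t) (fun _ => ⟨1, le_rfl, h1⟩) (fun _ => ⟨n, h1, le_rfl⟩)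
    (fun _ => h1) (by ring) fun i => ?_).mono (fun g hg => ⟨hg, fun _ => h1, ?_, ?_⟩) le_rfl
    fun _ _ _ h => h
  · show (n : ℤ) - 1 < _
    linarith
  · intro x _ _ i hx _
    have := (hg.mem x i).1
    rw [hx] at this
    exact SignType.intCast_nonneg.1 (by linarith)
  · intro x _ _ i hx _
    have := (hg.mem x i).2
    rw [hx] at this
    exact SignType.intCast_nonpos.1 (by linarith)

end Planar

/-! ### Splitting the coordinates: slices and sections -/

section Decomposition

variable {n : ℕ} {α β : Type}

/-- In the slice of `x`, the point `y` is moved upwards. -/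
def SliceUp (g : (α ⊕ β → Side n) → Option (α ⊕ β) → SignType) (x : α → Side n)
    (y : β → Side n) : Prop :=
  ∀ i, 0 ≤ g (Sum.elim x y) (some (Sum.inr i))

/-- In the slice of `x`, the point `y` is moved downwards. -/
def SliceDown (g : (α ⊕ β → Side n) → Option (α ⊕ β) → SignType) (x : α → Side n)
    (y : β → Side n) : Prop :=
  ∀ i, g (Sum.elim x y) (some (Sum.inr i)) ≤ 0

/-- The signs of a section `y` in the coordinates from `α`, and the last sign. -/
def sectionSigns (g : (α ⊕ β → Side n) → Option (α ⊕ β) → SignType)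
    (y : (α → Side n) → β → Side n) (x : α → Side n) (j : Option α) : SignType :=
  g (Sum.elim x (y x)) (j.map Sum.inl)

theorem elim_le_elim {x x' : α → Side n} {y y' : β → Side n} (hx : x ≤ x') (hy : y ≤ y') :
    Sum.elim x y ≤ Sum.elim x' y' := by
  rintro (i | i)
  exacts [hx i, hy i]

/-- Monotonicity of the section is enough; `y x` need not be a fixed point in the slice of `x`. -/
theorem Admissible.sectionSigns {g : (α ⊕ β → Side n) → Option (α ⊕ β) → SignType}
    (hg : Admissible g) {y : (α → Side n) → β → Side n} (hy : Monotone y) :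
    Admissible (sectionSigns g y) where
  mem x i := hg.mem (Sum.elim x (y x)) (Sum.inl i)
  mono _ _ h i := hg.mono _ _ (elim_le_elim h (hy h)) (Sum.inl i)
  mono_none _ _ h := hg.mono_none _ _ (elim_le_elim h (hy h))

theorem Admissible.slice_mono {g : (α ⊕ β → Side n) → Option (α ⊕ β) → SignType}
    (hg : Admissible g) (x : α → Side n) {y y' : β → Side n} (hy : y ≤ y') (j : Option α) :
    g (Sum.elim x y) (j.map Sum.inl) ≤ g (Sum.elim x y') (j.map Sum.inl) := by
  have h := elim_le_elim (le_refl x) hy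
  cases j with
  | none => exact hg.mono_none _ _ h
  | some i => exact hg.sign_le h rfl

/-- In each coordinate the supremum agrees with `y` or `y'`, and the slice map at `x'` dominates the
values at both. A lower bound can therefore be carried to all larger slices. -/
theorem SliceUp.sup {g : (α ⊕ β → Side n) → Option (α ⊕ β) → SignType} (hg : Admissible g)
    {x x' : α → Side n} {y y' : β → Side n} (hx : x ≤ x') (h : SliceUp g x y)
    (h' : SliceUp g x' y') : SliceUp g x' (y' ⊔ y) := by
  intro i
  rw [← SignType.intCast_nonneg]
  have h1 := hg.mono _ _ (elim_le_elim hx (le_sup_right : y ≤ y' ⊔ y)) (Sum.inr i)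
  have h2 := hg.mono _ _ (elim_le_elim (le_refl x') (le_sup_left : y' ≤ y' ⊔ y)) (Sum.inr i)
  have h3 := SignType.intCast_nonneg.2 (h i)
  have h4 := SignType.intCast_nonneg.2 (h' i)
  simp only [Sum.elim_inr] at h1 h2
  rcases le_total (y i) (y' i) with hc | hc
  · have : (y' ⊔ y) i = y' i := sup_eq_left.2 hc
    rw [this] at h2
    linarith
  · have : (y' ⊔ y) i = y i := sup_eq_right.2 hc
    rw [this] at h1
    linarith

theorem SliceDown.inf {g : (α ⊕ β → Side n) → Option (α ⊕ β) → SignType} (hg : Admissible g)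
    {x x' : α → Side n} {y y' : β → Side n} (hx : x' ≤ x) (h : SliceDown g x y)
    (h' : SliceDown g x' y') : SliceDown g x' (y' ⊓ y) := by
  intro i
  rw [← SignType.intCast_nonpos]
  have h1 := hg.mono _ _ (elim_le_elim hx (inf_le_right : y' ⊓ y ≤ y)) (Sum.inr i)
  have h2 := hg.mono _ _ (elim_le_elim (le_refl x') (inf_le_left : y' ⊓ y ≤ y')) (Sum.inr i)
  have h3 := SignType.intCast_nonpos.2 (h i)
  have h4 := SignType.intCast_nonpos.2 (h' i)
  simp only [Sum.elim_inr] at h1 h2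
  rcases le_total (y' i) (y i) with hc | hc
  · have : (y' ⊓ y) i = y' i := inf_eq_left.2 hc
    rw [this] at h2
    linarith
  · have : (y' ⊓ y) i = y i := inf_eq_right.2 hc
    rw [this] at h1
    linarith

/-! ### Shrinking the box in one slice -/

/-- The projection of `y` to the box `[l, r]`. -/
def clamp (l r y : β → Side n) : β → Side n := (y ⊔ l) ⊓ r

/-- The answers to queries in a slice, clamped to the box `[l, r]`, with the last sign given by
comparing the sign number `j` with `θ`. -/
noncomputable def clampedAnswer (l r : β → Side n) (j : Option α) (θ : SignType) (y : β → Side n)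
    (a : Option (α ⊕ β) → SignType) : Option β → SignType
  | none => if θ ≤ a (j.map Sum.inl) then 1 else -1
  | some i => if y i < l i then 1 else if r i < y i then -1 else a (some (Sum.inr i))

theorem le_clamp {l r : β → Side n} (hlr : l ≤ r) (y : β → Side n) : l ≤ clamp l r y :=
  le_inf le_sup_right hlr

theorem clamp_le (l r y : β → Side n) : clamp l r y ≤ r := inf_le_right

theorem clamp_mono (l r : β → Side n) {y y' : β → Side n} (h : y ≤ y') :
    clamp l r y ≤ clamp l r y' :=
  inf_le_inf_right _ (sup_le_sup_right h _)

theorem clamp_apply_of_lt {l r y : β → Side n} (hlr : l ≤ r) {i : β} (h : y i < l i) :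
    clamp l r y i = l i := by
  show (y i ⊔ l i) ⊓ r i = l i
  rw [sup_eq_right.2 h.le, inf_eq_left.2 (hlr i)]

theorem clamp_apply_of_gt {l r y : β → Side n} {i : β} (h : r i < y i) :
    clamp l r y i = r i := by
  show (y i ⊔ l i) ⊓ r i = r i
  rw [inf_eq_right.2 (h.le.trans le_sup_left)]

theorem clamp_apply_of_mem {l r y : β → Side n} {i : β} (h : l i ≤ y i) (h' : y i ≤ r i) :
    clamp l r y i = y i := by
  show (y i ⊔ l i) ⊓ r i = y i
  rw [sup_eq_left.2 h, inf_eq_left.2 h']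

/-- The points above `l` are mapped to points above `l`. -/
theorem SliceUp.le_of_le {g : (α ⊕ β → Side n) → Option (α ⊕ β) → SignType} (hg : Admissible g)
    {x : α → Side n} {l y : β → Side n} (h : SliceUp g x l) (hy : l ≤ y) (i : β) :
    (l i : ℤ) ≤ y i + g (Sum.elim x y) (some (Sum.inr i)) := by
  have h1 := hg.mono _ _ (elim_le_elim (le_refl x) hy) (Sum.inr i)
  have h2 := SignType.intCast_nonneg.2 (h i)
  simp only [Sum.elim_inr] at h1
  linarith

theorem SliceDown.le_of_le {g : (α ⊕ β → Side n) → Option (α ⊕ β) → SignType} (hg : Admissible g)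
    {x : α → Side n} {r y : β → Side n} (h : SliceDown g x r) (hy : y ≤ r) (i : β) :
    (y i : ℤ) + g (Sum.elim x y) (some (Sum.inr i)) ≤ r i := by
  have h1 := hg.mono _ _ (elim_le_elim (le_refl x) hy) (Sum.inr i)
  have h2 := SignType.intCast_nonpos.2 (h i)
  simp only [Sum.elim_inr] at h1
  linarith

/-- The box `[l, r]` is mapped into itself by the slice of `x`. -/
structure SliceBox (g : (α ⊕ β → Side n) → Option (α ⊕ β) → SignType) (x : α → Side n)
    (l r : β → Side n) : Prop where
  le : l ≤ r
  up : SliceUp g x l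
  down : SliceDown g x r

/-- Coordinates outside `[l, r]` step towards it and cannot pass its nearer end; those inside keep
their values in it. Hence order is preserved across the boundary. The last sign is a threshold of a
monotone sign. -/
theorem SliceBox.admissible_clampedAnswer {g : (α ⊕ β → Side n) → Option (α ⊕ β) → SignType}
    (hg : Admissible g) {x : α → Side n} {l r : β → Side n} (h : SliceBox g x l r) (j : Option α)
    (θ : SignType) :
    Admissible fun y => clampedAnswer l r j θ y (g (Sum.elim x (clamp l r y))) := by
  have value : ∀ y i, l i ≤ y i → y i ≤ r i → (l i : ℤ) ≤
      (y i : ℤ) + g (Sum.elim x (clamp l r y)) (some (Sum.inr i)) ∧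
      (y i : ℤ) + g (Sum.elim x (clamp l r y)) (some (Sum.inr i)) ≤ r i := by
    intro y i h1 h2
    have h3 := h.up.le_of_le hg (le_clamp h.le y) i
    have h4 := h.down.le_of_le hg (clamp_le l r y) i
    rw [clamp_apply_of_mem h1 h2] at h3 h4
    exact ⟨h3, h4⟩
  have hlr : ∀ i, (l i : ℤ) ≤ r i := fun i => h.le i
  refine ⟨fun y i => ?_, fun y y' hy i => ?_, fun y y' hy => ?_⟩
  · have h1 := (y i).2
    have h2 := (l i).2
    have h3 := (r i).2
    rw [Set.mem_Icc] at h1 h2 h3 ⊢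
    unfold clampedAnswer
    dsimp only
    split_ifs with c1 c2
    · have : (y i : ℤ) < l i := c1
      rw [SignType.coe_one]; omega
    · have : (r i : ℤ) < y i := c2
      rw [SignType.coe_neg_one]; omega
    · have := value y i (not_lt.1 c1) (not_lt.1 c2)
      omega
  · have h1 : (y i : ℤ) ≤ y' i := hy i
    have h2 := hlr i
    unfold clampedAnswer
    dsimp only
    split_ifs with c1 c2 c3 c4 c5 c6 c7 c8
    all_goals
      simp only [SignType.coe_one, SignType.coe_neg_one, not_lt, ← Subtype.coe_lt_coe,
        ← Subtype.coe_le_coe] at *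
    all_goals first
      | omega
      | (have := value y' i ‹_› ‹_›; omega)
      | (have := value y i ‹_› ‹_›; omega)
      | skip
    have h3 := hg.mono _ _ (elim_le_elim (le_refl x) (clamp_mono l r hy)) (Sum.inr i)
    simp only [Sum.elim_inr] at h3
    rwa [clamp_apply_of_mem ‹_› ‹_›, clamp_apply_of_mem ‹_› ‹_›] at h3
  · have h1 := hg.slice_mono x (clamp_mono l r hy) j
    unfold clampedAnswer
    dsimp only
    split_ifs with c1 c2
    · exact le_rfl
    · exact absurd (c1.trans h1) c2
    · decide
    · exact le_rfl

/-- A coordinate above `r` would have answer -1. One below `l` is clamped to `l i`, and there the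
slice map cannot go down. -/
theorem SliceBox.up_clamp {g : (α ⊕ β → Side n) → Option (α ⊕ β) → SignType}
    (hg : Admissible g) {x : α → Side n} {l r : β → Side n} (h : SliceBox g x l r) {j : Option α}
    {θ : SignType} {y : β → Side n}
    (hy : ∀ i, 0 ≤ clampedAnswer l r j θ y (g (Sum.elim x (clamp l r y))) (some i)) :
    SliceUp g x (clamp l r y) := by
  intro i
  have hi := hy i
  unfold clampedAnswer at hi
  dsimp only at hi
  split_ifs at hi with c1 c2
  · have := h.up.le_of_le hg (le_clamp h.le y) i
    rw [clamp_apply_of_lt h.le c1] at this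
    exact SignType.intCast_nonneg.1 (by linarith)
  · exact absurd hi (by decide)
  · exact hi

theorem SliceBox.down_clamp {g : (α ⊕ β → Side n) → Option (α ⊕ β) → SignType}
    (hg : Admissible g) {x : α → Side n} {l r : β → Side n} (h : SliceBox g x l r) {j : Option α}
    {θ : SignType} {y : β → Side n}
    (hy : ∀ i, clampedAnswer l r j θ y (g (Sum.elim x (clamp l r y))) (some i) ≤ 0) :
    SliceDown g x (clamp l r y) := by
  intro i
  have hi := hy i
  unfold clampedAnswer at hi
  dsimp only at hi
  split_ifs at hi with c1 c2
  · exact absurd hi (by decide)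
  · have := h.down.le_of_le hg (clamp_le l r y) i
    rw [clamp_apply_of_gt c2] at this
    exact SignType.intCast_nonpos.1 (by linarith)
  · exact hi

/-- A box can be shrunk so that one threshold of one sign is decided on all of it. -/
theorem achieves_threshold {q : ℕ} (hβ : Solvable n β q) (x : α → Side n) (l r : β → Side n)
    (j : Option α) (θ : SignType) :
    Achieves (fun g : (α ⊕ β → Side n) → Option (α ⊕ β) → SignType =>
        Admissible g ∧ SliceBox g x l r) (q + 1)
      fun g (p : (β → Side n) × (β → Side n)) =>
        SliceBox g x p.1 p.2 ∧ l ≤ p.1 ∧ p.2 ≤ r ∧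
          ((∀ y, p.1 ≤ y → y ≤ p.2 → θ ≤ g (Sum.elim x y) (j.map Sum.inl)) ∨
            ∀ y, p.1 ≤ y → y ≤ p.2 → ¬ θ ≤ g (Sum.elim x y) (j.map Sum.inl)) := by
  have h1 := (Achieves.simulate hβ (fun y => Sum.elim x (clamp l r y))
    (clampedAnswer l r j θ)).mono (𝒢' := fun g => Admissible g ∧ SliceBox g x l r)
    (fun g hg => hg.2.admissible_clampedAnswer hg.1 j θ) le_rfl (fun _ _ _ h => h)
  refine h1.bind fun y => ?_
  refine (Achieves.query _ (Sum.elim x (clamp l r y))).bind (e := 0) fun a => ?_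
  refine .pure 0 (if θ ≤ a (j.map Sum.inl) then (clamp l r y, r) else (l, clamp l r y)) ?_
  rintro g ⟨⟨⟨hg, hbox⟩, hs⟩, rfl⟩
  split_ifs with hθ
  · refine ⟨⟨clamp_le l r y, hbox.up_clamp hg (j := j) (θ := θ) fun i => ?_, hbox.down⟩,
      le_clamp hbox.le y, le_rfl, .inl fun z hz _ => hθ.trans (hg.slice_mono x hz j)⟩
    -- The simulated last sign is never 0, so it determines which kind of solution was found.
    refine hs.resolve_left (fun hs => ?_) (some i)
    have := hs none
    simp only [clampedAnswer, if_pos hθ] at this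
    exact absurd this (by decide)
  · refine ⟨⟨le_clamp hbox.le y, hbox.up, hbox.down_clamp hg (j := j) (θ := θ) fun i => ?_⟩,
      le_rfl, clamp_le l r y, .inr fun z _ hz hz' => hθ (hz'.trans (hg.slice_mono x hz j))⟩
    refine hs.resolve_right (fun hs => ?_) (some i)
    have := hs none
    simp only [clampedAnswer, if_neg hθ] at this
    exact absurd this (by decide)

/-- Earlier decisions survive later shrinking, since they hold on the whole box. -/
theorem achieves_thresholds {q : ℕ} (hβ : Solvable n β q) (x : α → Side n)
    (tests : List (Option α × SignType)) : ∀ l r : β → Side n,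
    Achieves (fun g : (α ⊕ β → Side n) → Option (α ⊕ β) → SignType =>
        Admissible g ∧ SliceBox g x l r) (tests.length * (q + 1))
      fun g (p : (β → Side n) × (β → Side n)) =>
        SliceBox g x p.1 p.2 ∧ l ≤ p.1 ∧ p.2 ≤ r ∧ ∀ t ∈ tests,
          ((∀ y, p.1 ≤ y → y ≤ p.2 → t.2 ≤ g (Sum.elim x y) (t.1.map Sum.inl)) ∨
            ∀ y, p.1 ≤ y → y ≤ p.2 → ¬ t.2 ≤ g (Sum.elim x y) (t.1.map Sum.inl)) := by
  induction tests with
  | nil => exact fun l r => .pure _ (l, r) fun g hg => ⟨hg.2, le_rfl, le_rfl, by simp⟩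
  | cons t tests ih =>
    intro l r
    refine ((achieves_threshold hβ x l r t.1 t.2).bind fun p =>
      (ih p.1 p.2).mono (P' := fun g p' => (SliceBox g x p'.1 p'.2 ∧ l ≤ p'.1 ∧ p'.2 ≤ r ∧
        ∀ t' ∈ t :: tests, ((∀ y, p'.1 ≤ y → y ≤ p'.2 →
          t'.2 ≤ g (Sum.elim x y) (t'.1.map Sum.inl)) ∨
            ∀ y, p'.1 ≤ y → y ≤ p'.2 → ¬ t'.2 ≤ g (Sum.elim x y) (t'.1.map Sum.inl))))
        (fun g hg => ⟨hg.1.1, hg.2.1⟩) le_rfl ?_).mono (fun _ h => h) ?_ fun _ _ _ h => h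
    · rintro g p' ⟨-, -, h2, h3, h4⟩ ⟨k1, k2, k3, k4⟩
      refine ⟨k1, h2.trans k2, k3.trans h3, fun t' ht' => ?_⟩
      rcases List.mem_cons.1 ht' with rfl | ht'
      · exact h4.imp (fun h y hy hy' => h y (k2.trans hy) (hy'.trans k3))
          fun h y hy hy' => h y (k2.trans hy) (hy'.trans k3)
      · exact k4 t' ht'
    · rw [List.length_cons]
      exact le_of_eq (by ring)

/-- The number of queries that decide all outer signs in a slice. -/
def sliceCost (α : Type) [Fintype α] (q : ℕ) : ℕ := 3 * (Fintype.card α + 1) * (q + 1) + 1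

/-- A box can be shrunk so that all outer signs are constant on it. -/
theorem achieves_slice [Fintype α] {q : ℕ} (hβ : Solvable n β q) (x : α → Side n)
    (l r : β → Side n) :
    Achieves (fun g : (α ⊕ β → Side n) → Option (α ⊕ β) → SignType =>
        Admissible g ∧ SliceBox g x l r) (sliceCost α q)
      fun g (p : ((β → Side n) × (β → Side n)) × (Option α → SignType)) =>
        SliceBox g x p.1.1 p.1.2 ∧ l ≤ p.1.1 ∧ p.1.2 ≤ r ∧
          ∀ y, p.1.1 ≤ y → y ≤ p.1.2 → ∀ j, g (Sum.elim x y) (j.map Sum.inl) = p.2 j := by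
  have hlen : (Finset.univ : Finset (Option α × SignType)).toList.length =
      3 * (Fintype.card α + 1) := by
    rw [Finset.length_toList, Finset.card_univ, Fintype.card_prod, Fintype.card_option]
    rw [show Fintype.card SignType = 3 from rfl, mul_comm]
  have h1 := achieves_thresholds hβ x (Finset.univ : Finset (Option α × SignType)).toList l r
  rw [hlen] at h1
  refine h1.bind fun p => ?_
  refine (Achieves.query _ (Sum.elim x p.1)).bind (e := 0) fun a => ?_
  refine .pure 0 (p, fun j => a (j.map Sum.inl)) ?_
  rintro g ⟨⟨-, hbox, hl, hr, ht⟩, rfl⟩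
  refine ⟨hbox, hl, hr, fun y hy hy' j => ?_⟩
  have key : ∀ y z, p.1 ≤ y → y ≤ p.2 → p.1 ≤ z → z ≤ p.2 →
      g (Sum.elim x y) (j.map Sum.inl) ≤ g (Sum.elim x z) (j.map Sum.inl) := by
    intro y z h1 h2 h3 h4
    -- The threshold is the sign at `y` itself, so the negative alternative fails at `y`.
    rcases ht (j, g (Sum.elim x y) (j.map Sum.inl)) (Finset.mem_toList.2 (Finset.mem_univ _))
      with h | h
    · exact h z h3 h4
    · exact absurd le_rfl (h y h1 h2)
  exact le_antisymm (key _ _ hy hy' le_rfl hbox.le) (key _ _ le_rfl hbox.le hy hy')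

/-! ### Running the outer algorithm on an undetermined section -/

/-- Lower and upper bounds, in all slices, for the section that the outer algorithm sees. -/
structure SectionBounds (g : (α ⊕ β → Side n) → Option (α ⊕ β) → SignType)
    (L R : (α → Side n) → β → Side n) : Prop where
  lower_mono : Monotone L
  upper_mono : Monotone R
  box : ∀ x, SliceBox g x (L x) (R x)

open Classical in
/-- Raise the lower bounds above `x` to at least `l`. -/
noncomputable def raise (L : (α → Side n) → β → Side n) (x : α → Side n) (l : β → Side n) :
    (α → Side n) → β → Side n :=
  fun z => if x ≤ z then L z ⊔ l else L z

open Classical in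
/-- Reduce the upper bounds below `x` to at most `r`. -/
noncomputable def reduce (R : (α → Side n) → β → Side n) (x : α → Side n) (r : β → Side n) :
    (α → Side n) → β → Side n :=
  fun z => if z ≤ x then R z ⊓ r else R z

theorem le_raise (L : (α → Side n) → β → Side n) (x : α → Side n) (l : β → Side n) :
    L ≤ raise L x l := by
  intro z
  unfold raise
  split_ifs
  exacts [le_sup_left, le_rfl]

theorem reduce_le (R : (α → Side n) → β → Side n) (x : α → Side n) (r : β → Side n) :
    reduce R x r ≤ R := by
  intro z
  unfold reduce
  split_ifs
  exacts [inf_le_left, le_rfl]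

theorem le_raise_self (L : (α → Side n) → β → Side n) (x : α → Side n) (l : β → Side n) :
    l ≤ raise L x l x := by
  rw [raise, if_pos le_rfl]
  exact le_sup_right

theorem reduce_self_le (R : (α → Side n) → β → Side n) (x : α → Side n) (r : β → Side n) :
    reduce R x r x ≤ r := by
  rw [reduce, if_pos le_rfl]
  exact inf_le_right

/-- Raising all slices above `x` and reducing all slices below `x` keeps the bounds monotone. They
do not cross, since `l ≤ r ≤ R x ≤ R z` for `x ≤ z`, and dually. -/
theorem SectionBounds.refine {g : (α ⊕ β → Side n) → Option (α ⊕ β) → SignType}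
    (hg : Admissible g) {L R : (α → Side n) → β → Side n} (h : SectionBounds g L R)
    {x : α → Side n} {l r : β → Side n} (hbox : SliceBox g x l r) (hl : L x ≤ l) (hr : r ≤ R x) :
    SectionBounds g (raise L x l) (reduce R x r) := by
  refine ⟨fun z z' hz => ?_, fun z z' hz => ?_, fun z => ⟨?_, ?_, ?_⟩⟩
  · unfold raise
    split_ifs with h1 h2
    · exact sup_le_sup_right (h.lower_mono hz) l
    · exact absurd (h1.trans hz) h2
    · exact (h.lower_mono hz).trans le_sup_left
    · exact h.lower_mono hz
  · unfold reduce
    split_ifs with h1 h2 h2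
    · exact inf_le_inf_right r (h.upper_mono hz)
    · exact inf_le_left.trans (h.upper_mono hz)
    · exact absurd (hz.trans h2) h1
    · exact h.upper_mono hz
  · have hLR := (h.box z).le
    unfold raise reduce
    split_ifs with h1 h2 h2
    · obtain rfl := le_antisymm h1 h2
      exact sup_le (le_inf hLR (hl.trans hbox.le)) (le_inf (hbox.le.trans hr) hbox.le)
    · exact sup_le hLR (hbox.le.trans (hr.trans (h.upper_mono h1)))
    · exact le_inf hLR ((h.lower_mono h2).trans (hl.trans hbox.le))
    · exact hLR
  · unfold raise
    split_ifs with h1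
    · exact SliceUp.sup hg h1 hbox.up (h.box z).up
    · exact (h.box z).up
  · unfold reduce
    split_ifs with h1
    · exact SliceDown.inf hg h1 hbox.down (h.box z).down
    · exact (h.box z).down

/-- Quantifying the promise over all monotone sections between the bounds makes the induction on `T`
work: an answer common to all remaining sections moves the promise to the subtree. The factor `d +
1` counts the outer queries and the slice of the output. -/
theorem achieves_outer [Fintype α] {q : ℕ} (hβ : Solvable n β q) :
    ∀ (T : QueryAlgorithm (α → Side n) (Option α → SignType) (α → Side n)) (d : ℕ)
      (L R : (α → Side n) → β → Side n),
    Achieves (fun g => Admissible g ∧ SectionBounds g L R ∧ ∀ y, Monotone y → L ≤ y → y ≤ R →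
        Solution (sectionSigns g y) (T.run (sectionSigns g y)) ∧
          T.numQueries (sectionSigns g y) ≤ d)
      ((d + 1) * sliceCost α q) (Solution (ι := α ⊕ β) (n := n)) := by
  intro T
  induction T with
  | output x =>
    intro d L R
    have h1 := (achieves_slice hβ x (L x) (R x)).mono
      (𝒢' := fun g => Admissible g ∧ SectionBounds g L R ∧ ∀ y, Monotone y → L ≤ y → y ≤ R →
        Solution (sectionSigns g y) ((QueryAlgorithm.output x).run (sectionSigns g y)) ∧
          (QueryAlgorithm.output x).numQueries (sectionSigns g y) ≤ d)
      (fun g hg => ⟨hg.1, hg.2.1.box x⟩) le_rfl (fun _ _ _ h => h)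
    refine (h1.bind (e := 0) (P' := Solution) fun p => ?_).mono (fun _ h => h)
      (by rw [add_zero]; exact Nat.le_mul_of_pos_left _ d.succ_pos) fun _ _ _ h => h
    obtain ⟨⟨l, r⟩, v⟩ := p
    -- The end `r` is moved downwards and suits nonpositive outer signs; `l` is moved upwards and
    -- suits nonnegative ones.
    by_cases hv : ∀ j, v j ≤ 0
    · refine .pure 0 (Sum.elim x r) ?_
      rintro g ⟨-, hbox, -, -, hc⟩
      left
      have := hc r hbox.le le_rfl
      rintro (_ | i | i)
      · exact (this none).trans_le (hv none)
      · exact (this (some i)).trans_le (hv (some i))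
      · exact hbox.down i
    · refine .pure 0 (Sum.elim x l) ?_
      rintro g ⟨⟨hg, hLR, hsol⟩, hbox, hl, hr, hc⟩
      have hb := hLR.refine hg hbox hl hr
      -- The raised lower bound is an eligible section through the shrunken box, so its outer signs
      -- at `x` are `v`.
      have h2 := (hsol (raise L x l) hb.lower_mono (le_raise L x l)
        (fun z => (hb.box z).le.trans (reduce_le R x r z))).1
      have h3 : ∀ j, sectionSigns g (raise L x l) x j = v j :=
        hc _ (le_raise_self L x l) ((hb.box x).le.trans (reduce_self_le R x r))
      have h4 : ∀ j, 0 ≤ v j := by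
        rcases h2 with h2 | h2
        · exact absurd (fun j => (h3 j).symm.trans_le (h2 j)) hv
        · exact fun j => (h2 j).trans_eq (h3 j)
      right
      have := hc l le_rfl hbox.le
      rintro (_ | i | i)
      · exact (h4 none).trans_eq (this none).symm
      · exact (h4 (some i)).trans_eq (this (some i)).symm
      · exact hbox.up i
  | query x next ih =>
    intro d L R
    -- With `d = 0` the promise is contradictory, as the section `L` already costs a query.
    rcases d with _ | d
    · refine .pure _ (Sum.elim x (L x)) ?_
      rintro g ⟨-, hLR, hsol⟩
      have := (hsol L hLR.lower_mono le_rfl fun z => (hLR.box z).le).2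
      simp [QueryAlgorithm.numQueries] at this
    have h1 := (achieves_slice hβ x (L x) (R x)).mono
      (𝒢' := fun g => Admissible g ∧ SectionBounds g L R ∧ ∀ y, Monotone y → L ≤ y → y ≤ R →
        Solution (sectionSigns g y) ((QueryAlgorithm.query x next).run (sectionSigns g y)) ∧
          (QueryAlgorithm.query x next).numQueries (sectionSigns g y) ≤ d + 1)
      (fun g hg => ⟨hg.1, hg.2.1.box x⟩) le_rfl (fun _ _ _ h => h)
    refine (h1.bind (P' := Solution) fun p => (ih p.2 d (raise L x p.1.1)
      (reduce R x p.1.2)).mono ?_ le_rfl fun _ _ _ h => h).mono (fun _ h => h)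
      (le_of_eq (by ring)) fun _ _ _ h => h
    rintro g ⟨⟨hg, hLR, hsol⟩, hbox, hl, hr, hc⟩
    have hb := hLR.refine hg hbox hl hr
    refine ⟨hg, hb, fun y hy hLy hyR => ?_⟩
    have h2 := hsol y hy ((le_raise L x _).trans hLy) (hyR.trans (reduce_le R x _))
    have h3 : sectionSigns g y x = p.2 := funext <|
      hc _ ((le_raise_self L x _).trans (hLy x)) ((hyR x).trans (reduce_self_le R x _))
    simp only [QueryAlgorithm.run, QueryAlgorithm.numQueries, h3] at h2
    exact ⟨h2.1, Nat.le_of_succ_le_succ h2.2⟩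

theorem Solvable.sum [Fintype α] (hn : 1 ≤ n) {p q : ℕ} (hα : Solvable n α p)
    (hβ : Solvable n β q) : Solvable n (α ⊕ β) ((p + 1) * sliceCost α q) := by
  obtain ⟨T, hT⟩ := hα
  have h1 : (1 : ℤ) ≤ n := by exact_mod_cast hn
  refine (achieves_outer hβ T p (fun _ _ => ⟨1, le_rfl, h1⟩) fun _ _ => ⟨n, h1, le_rfl⟩).mono
    (fun g hg => ⟨hg, ⟨monotone_const, monotone_const, fun x => ⟨fun _ => h1, fun i => ?_,
      fun i => ?_⟩⟩, fun y hy _ _ => hT _ (hg.sectionSigns hy)⟩) le_rfl fun _ _ _ h => h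
  · have := (hg.mem (Sum.elim x fun _ => ⟨1, le_rfl, h1⟩) (Sum.inr i)).1
    simp only [Sum.elim_inr] at this
    exact SignType.intCast_nonneg.1 (by linarith)
  · have := (hg.mem (Sum.elim x fun _ => ⟨n, h1, le_rfl⟩) (Sum.inr i)).2
    simp only [Sum.elim_inr] at this
    exact SignType.intCast_nonpos.1 (by linarith)

end Decomposition

/-! ### Induction on the dimension -/

theorem solvable_fin (k : ℕ) : ∃ C : ℕ, ∀ n t : ℕ, 1 ≤ n → 1 ≤ t → n ≤ 2 ^ t →
    Solvable n (Fin k) (C * t ^ ((k + 1) / 2)) := by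
  induction k using Nat.twoStepInduction with
  | zero => exact ⟨0, fun n t _ _ _ => (solvable_of_isEmpty n (Fin 0)).mono (Nat.zero_le _)⟩
  | one =>
    refine ⟨12, fun n t hn ht hnt => ?_⟩
    exact (((solvable_two hn hnt).reindex
      (finSumFinEquiv (m := 1) (n := 1)).symm).of_sum (β := Fin 1)).mono
      (by norm_num; omega)
  | more k ih _ =>
    obtain ⟨C, hC⟩ := ih
    -- The 13 comes from `4 * (2 * t + 1) + 1 ≤ 13 * t`; the summands 1 are absorbed by `1 ≤ t`.
    refine ⟨(C + 1) * (3 * (Fintype.card (Fin k) + 1) * 13 + 1), fun n t hn ht hnt => ?_⟩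
    refine ((Solvable.sum hn (hC n t hn ht hnt) (solvable_two hn hnt)).reindex
      finSumFinEquiv).mono ?_
    have h1 : C * t ^ ((k + 1) / 2) + 1 ≤ (C + 1) * t ^ ((k + 1) / 2) := by
      have := Nat.one_le_pow ((k + 1) / 2) t ht
      linarith
    have h2 : sliceCost (Fin k) (4 * (2 * t + 1)) ≤
        (3 * (Fintype.card (Fin k) + 1) * 13 + 1) * t := by
      have : 4 * (2 * t + 1) + 1 ≤ 13 * t := by omega
      calc _ ≤ 3 * (Fintype.card (Fin k) + 1) * (13 * t) + t :=
            add_le_add (Nat.mul_le_mul_left _ this) ht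
        _ = _ := by ring
    calc _ ≤ _ := Nat.mul_le_mul h1 h2
      _ = _ := by rw [show (k + 2 + 1) / 2 = (k + 1) / 2 + 1 by omega]; ring

/-! ### Back to the original formulation and to real logarithms -/

/-- The indices `Fin (k + 1)` of the signs of Tarski*(n, k), with `none` for the last one. -/
def signIndex (k : ℕ) : Option (Fin k) → Fin (k + 1) := fun j => j.elim (Fin.last k) Fin.castSucc

theorem signIndex_surjective (k : ℕ) : Function.Surjective (signIndex k) := fun i =>
  Fin.lastCases ⟨none, rfl⟩ (fun i => ⟨some i, rfl⟩) i

theorem IsTarskiStarInput.admissible {n k : ℕ} {g : Grid n k → SignVec (k + 1)}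
    (hg : IsTarskiStarInput g) : Admissible fun x j => g x (signIndex k j) where
  mem := hg.mem
  mono x y h i := by
    have := hg.mono x y h i.castSucc
    simp only [shift, Pi.add_apply, Fin.snoc_castSucc] at this
    exact this
  mono_none x y h := by
    have := hg.mono x y h (Fin.last k)
    simp only [shift, Pi.add_apply, Fin.snoc_last, zero_add] at this
    exact SignType.intCast_le.1 this

theorem Solvable.exists_algorithm {n k d : ℕ} (h : Solvable n (Fin k) d) :
    ∃ T : TarskiStarAlgorithm n k, SolvesTarskiStar T ∧
      ∀ g : Grid n k → SignVec (k + 1), IsTarskiStarInput g → T.numQueries g ≤ d := by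
  obtain ⟨T, hT⟩ := h.simulate id fun _ (a : SignVec (k + 1)) j => a (signIndex k j)
  refine ⟨T, fun g hg => ?_, fun g hg => (hT g hg.admissible).2⟩
  exact (hT g hg.admissible).1.imp (fun h => (signIndex_surjective k).forall.2 h)
    fun h => (signIndex_surjective k).forall.2 h

/-- Needed separately because log 1 = 0 leaves no room for a query when `k > 0`. -/
theorem solvable_one (k : ℕ) : Solvable 1 (Fin k) 0 := by
  refine Achieves.pure 0 (fun _ => ⟨1, by simp⟩) fun g hg => ?_
  have h0 : ∀ i, g (fun _ => ⟨1, by simp⟩) (some i) = 0 := by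
    intro i
    obtain ⟨h1, h2⟩ := hg.mem (fun _ => ⟨1, by simp⟩) i
    push_cast at h1 h2
    exact le_antisymm (SignType.intCast_nonpos.1 (by linarith))
      (SignType.intCast_nonneg.1 (by linarith))
  rcases le_total (g (fun _ => ⟨1, by simp⟩) none) 0 with h | h
  · exact .inl fun j => by
      rcases j with _ | i
      exacts [h, (h0 i).le]
  · exact .inr fun j => by
      rcases j with _ | i
      exacts [h, (h0 i).ge]

theorem exists_solvable_log (k : ℕ) : ∃ C : ℝ, ∀ n : ℕ+, ∃ d : ℕ, Solvable n (Fin k) d ∧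
    (d : ℝ) ≤ C * Real.log ((n : ℕ) : ℝ) ^ ((k + 1) / 2) := by
  obtain ⟨C, hC⟩ := solvable_fin k
  refine ⟨C * (2 / Real.log 2) ^ ((k + 1) / 2), fun n => ?_⟩
  obtain ⟨n, hn⟩ := n
  rcases Nat.eq_or_lt_of_le (show 1 ≤ n from hn) with rfl | h2
  · exact ⟨0, solvable_one k, by simp; positivity⟩
  have ht : 1 ≤ Nat.clog 2 n := Nat.clog_pos one_lt_two h2
  refine ⟨_, hC n _ hn ht (Nat.le_pow_clog one_lt_two n), ?_⟩
  have hlog2 := Real.log_pos one_lt_two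
  have hlt : 2 ^ (Nat.clog 2 n - 1) < n := Nat.pow_pred_clog_lt_self one_lt_two h2
  -- The factor 2 absorbs the rounding: the ceiling is at most log₂ n + 1, and 1 ≤ log₂ n.
  have key : ((Nat.clog 2 n : ℕ) : ℝ) ≤ 2 / Real.log 2 * Real.log n := by
    have h3 : ((Nat.clog 2 n - 1 : ℕ) : ℝ) * Real.log 2 ≤ Real.log n := by
      rw [← Real.log_pow]
      exact Real.log_le_log (by positivity) (by exact_mod_cast hlt.le)
    have h4 : Real.log 2 ≤ Real.log n := Real.log_le_log two_pos (by exact_mod_cast h2)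
    rw [Nat.cast_sub ht, Nat.cast_one] at h3
    rw [div_mul_eq_mul_div, le_div_iff₀ hlog2]
    linarith
  push_cast
  rw [mul_assoc, ← mul_pow]
  show _ ≤ (C : ℝ) * (2 / Real.log 2 * Real.log n) ^ ((k + 1) / 2)
  gcongr

theorem ceil_half (k : ℕ) : ⌈(k : ℚ) / 2⌉₊ = (k + 1) / 2 := by
  apply le_antisymm
  · rw [Nat.ceil_le, div_le_iff₀ two_pos]
    have : k ≤ (k + 1) / 2 * 2 := by omega
    exact_mod_cast this
  · have h1 : (k : ℚ) ≤ ⌈(k : ℚ) / 2⌉₊ * 2 := (div_le_iff₀ two_pos).1 (Nat.le_ceil _)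
    have h2 : k ≤ ⌈(k : ℚ) / 2⌉₊ * 2 := by exact_mod_cast h1
    omega

theorem lemma3p3 :
    ∃ T : (n : ℕ+) → (k : ℕ) → TarskiStarAlgorithm (n : ℕ) k,
      (∀ (n : ℕ+) (k : ℕ), SolvesTarskiStar (T n k)) ∧
      ∀ k : ℕ, ∃ C : ℝ, ∀ n : ℕ+, ∀ g : Grid (n : ℕ) k → SignVec (k + 1), IsTarskiStarInput g →
        ((T n k).numQueries g : ℝ) ≤ C * Real.log ((n : ℕ) : ℝ) ^ ⌈(k : ℚ) / 2⌉₊ := by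
  choose C hC using exists_solvable_log
  choose d hd hdC using hC
  choose T hT hcost using fun n k => (hd k n).exists_algorithm
  refine ⟨T, hT, fun k => ⟨C k, fun n g hg => ?_⟩⟩
  rw [ceil_half]
  exact (Nat.cast_le.2 (hcost n k g hg)).trans (hdC k n)
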